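/- Let $Q$ be a finite acyclic quiver with vertex set $Q_0$, $|Q_0|=n$, and let $F$ be an algebraically closed field. On $\mathbb{R}Q_0$, with coordinate basis vectors $\mathbf{i}$ ($i\in Q_0$) and standard scalar product $\mathbf{d}\cdot\mathbf{e}$, let $$\langle \mathbf{d},\mathbf{e}\rangle=\sum_{i\in Q_0} d_ie_i-\sum_{\alpha:i\to j}d_ie_j$$ be the Euler form, $(\mathbf{d},\mathbf{e})=\langle \mathbf{d},\mathbf{e}\rangle+\langle \mathbf{e},\mathbf{d}\rangle$ its symmetrization, and $\{\mathbf{d},\mathbf{e}\}=\langle \mathbf{d},\mathbf{e}\rangle-\langle \mathbf{e},\mathbf{d}\rangle$ its antisymmetrization. Assume that $Q$ is connected and wild, that is, the form $(\_,\_)$ is indefinite; then $n\ge 2$. Let $\lambda_1\le\lambda_2\le\dots\le\lambda_n$ be the eigenvalues, with multiplicity, of the Cartan matrix, which is the matrix of $(\_,\_)$ in the coordinate basis. Let $\mathbf{d}\in\mathbb{N}Q_0$ be a dimension vector in the interior of the fundamental domain $\{\mathbf{x}\in\mathbb{R}_{>0}Q_0 : (\mathbf{x},\mathbf{i})\le 0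 \text{ for all } i\in Q_0\}$; that is, $d_i>0$ and $(\mathbf{d},\mathbf{i})<0$ for all $i\in Q_0$. Assume that $(\mathbf{d},\mathbf{d})=(\lambda_1+\gamma)\,\mathbf{d}\cdot\mathbf{d}$, where $\gamma\ge 0$ satisfies $$\gamma<-\lambda_1\ \text{ if }\lambda_2\ge 0,\qquad \gamma<\frac{\lambda_1(\lambda_2-\lambda_1)}{\lambda_1+\lambda_2}\ \text{ if }\lambda_2<0.$$ Put $\kappa=-(\mathbf{d},\_)$, $\Theta=\{\mathbf{d},\_\}$ and $\mu=\Theta/\kappa$. For $0<\delta<1$, let $$\epsilon^{\rm eff}_{\mathbf{d}}(\delta)=\min\{\mu(\mathbf{d})-\mu(\mathbf{e}) : \mathbf{e}\in\mathbb{N}Q_0,\ 0\ne \mathbf{e}\le \mathbf{d},\ \langle \mathbf{e},\mathbf{d}-\mathbf{e}\rangle\ge 0,\ \kappa(\mathbf{e})\le\delta\,\kappa(\mathbf{d})\},$$ where $\min\emptyset=+\infty$. Then there is a constant $C>0$, independent of $\delta$, such that $\epsilon^{\rm eff}_{\mathbf{d}}(\delta)\ge C(1-\delta)>0$ for all $0<\delta<1$.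 Moreover, the sequence $(k\cdot\mathbf{d})_{k\ge 1}$ supports a uniform expander with respect to $\mu$: there are finite-dimensional representations $V^{(k)}$ of $Q$ over $F$ ($k\ge 1$) of dimension vectors $k\cdot\mathbf{d}$, of unbounded total dimension, such that for every $0<\delta<1$ there is an $\epsilon>0$ with the following property: for all $k\ge 1$, every non-zero subrepresentation $U\subset V^{(k)}$ with $\kappa(U)\le\delta\,\kappa(V^{(k)})$ satisfies $\mu(U)<\mu(V^{(k)})-\epsilon$. Here $\kappa$ and $\mu$ of a representation are those of its dimension vector. -/

import Mathlib

noncomputable section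

namespace QuiverExpander

/-! ### Quivers, the Euler form and the Cartan matrix

A finite quiver is a finite type `Q` of vertices with a `Quiver` structure all of whose
arrow types are finite. -/

/-- There are no oriented cycles: every oriented path from a vertex to itself is trivial. -/
def IsAcyclic (Q : Type*) [Quiver Q] : Prop :=
  ∀ (i : Q) (p : Quiver.Path i i), p.length = 0

/-- The underlying graph is connected: there is a vertex, and any two vertices are joined by
an unoriented path (a path in the quiver to which the reversed arrows have been added). -/
def IsConnected (Q : Type*) [Quiver Q] : Prop :=
  Nonempty Q ∧ Quiver.IsStronglyConnected (Quiver.Symmetrify Q)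

/-- The Euler form `⟨d, e⟩ = ∑ i, d i * e i - ∑ (α : i ⟶ j), d i * e j` on `ℝ^Q`. -/
def eulerForm (Q : Type*) [Quiver Q] [Fintype Q] [∀ i j : Q, Fintype (i ⟶ j)] :
    LinearMap.BilinForm ℝ (Q → ℝ) :=
  LinearMap.mk₂ ℝ
    (fun d e => ∑ i, d i * e i - ∑ i, ∑ j, ∑ _α : i ⟶ j, d i * e j)
    (fun d d' e => by
      simp only [Pi.add_apply, add_mul, Finset.sum_add_distrib]; ring)
    (fun c d e => by
      simp only [Pi.smul_apply, smul_eq_mul, mul_assoc, ← Finset.mul_sum, ← mul_sub])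
    (fun d e e' => by
      simp only [Pi.add_apply, mul_add, Finset.sum_add_distrib]; ring)
    (fun c d e => by
      simp only [Pi.smul_apply, smul_eq_mul, mul_left_comm _ c, ← Finset.mul_sum, ← mul_sub])

/-- The symmetrization `(d, e) = ⟨d, e⟩ + ⟨e, d⟩` of the Euler form. -/
def symForm (Q : Type*) [Quiver Q] [Fintype Q] [∀ i j : Q, Fintype (i ⟶ j)] :
    LinearMap.BilinForm ℝ (Q → ℝ) :=
  eulerForm Q + (eulerForm Q).flip

/-- The antisymmetrization `{d, e} = ⟨d, e⟩ - ⟨e, d⟩` of the Euler form. -/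
def antisymForm (Q : Type*) [Quiver Q] [Fintype Q] [∀ i j : Q, Fintype (i ⟶ j)] :
    LinearMap.BilinForm ℝ (Q → ℝ) :=
  eulerForm Q - (eulerForm Q).flip

/-- The Cartan matrix: the matrix of `symForm` in the coordinate basis. -/
def cartanMatrix (Q : Type*) [Quiver Q] [Fintype Q] [DecidableEq Q]
    [∀ i j : Q, Fintype (i ⟶ j)] : Matrix Q Q ℝ :=
  Matrix.of fun i j => symForm Q (Pi.single i 1) (Pi.single j 1)

theorem cartanMatrix_isHermitian (Q : Type*) [Quiver Q] [Fintype Q] [DecidableEq Q]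
    [∀ i j : Q, Fintype (i ⟶ j)] : (cartanMatrix Q).IsHermitian := by
  ext i j
  simp [cartanMatrix, symForm, add_comm]

/-- `cartanEigenvalue Q k` is the eigenvalue `lam_{k+1}` in the increasing enumeration
`lam_1 ≤ ... ≤ lam_n`, with multiplicity, of the eigenvalues of the Cartan matrix, where
`n` is the number of vertices (and `0` if `k ≥ n`). Mathlib enumerates them in decreasing
order, whence the reversal. -/
def cartanEigenvalue (Q : Type*) [Quiver Q] [Fintype Q] [DecidableEq Q]
    [∀ i j : Q, Fintype (i ⟶ j)] (k : ℕ) : ℝ :=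
  if h : k < Fintype.card Q then
    (cartanMatrix_isHermitian Q).eigenvalues₀ (Fin.rev ⟨k, h⟩)
  else 0

/-- A connected quiver is called wild if its Cartan form is indefinite. -/
def IsWild (Q : Type*) [Quiver Q] [Fintype Q] [∀ i j : Q, Fintype (i ⟶ j)] : Prop :=
  (∃ x : Q → ℝ, 0 < symForm Q x x) ∧ ∃ y : Q → ℝ, symForm Q y y < 0

/-- A dimension vector regarded as a real vector. -/
def vec {Q : Type*} (d : Q → ℕ) : Q → ℝ := fun i => (d i : ℝ)

/-- The fundamental domain: the vectors `d` with positive coordinates such that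
`(d, i) ≤ 0` for every coordinate vector `i`. -/
def fundamentalDomain (Q : Type*) [Quiver Q] [Fintype Q] [DecidableEq Q]
    [∀ i j : Q, Fintype (i ⟶ j)] : Set (Q → ℝ) :=
  {d | (∀ i, 0 < d i) ∧ ∀ i, symForm Q d (Pi.single i 1) ≤ 0}

/-! ### Slope functions and the numerical bound -/

/-- The slope function `μ = Θ / κ`. -/
def slope {Q : Type*} (Θ κ : Module.Dual ℝ (Q → ℝ)) (x : Q → ℝ) : ℝ := Θ x / κ x

/-- The minimum of `μ(d) - μ(e)` over all dimension vectors `0 ≠ e ≤ d` such that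
`⟨e, d - e⟩ ≥ 0` and `κ(e) ≤ δ κ(d)`. There are only finitely many such `e`; the minimum over
the empty set is `+∞`, which is why the value is an extended real number. -/
def effBound {Q : Type*} [Quiver Q] [Fintype Q] [∀ i j : Q, Fintype (i ⟶ j)]
    (Θ κ : Module.Dual ℝ (Q → ℝ)) (d : Q → ℕ) (δ : ℝ) : EReal :=
  sInf {r : EReal | ∃ e : Q → ℕ, e ≠ 0 ∧ e ≤ d ∧
    0 ≤ eulerForm Q (vec e) (vec d - vec e) ∧ κ (vec e) ≤ δ * κ (vec d) ∧
    r = ((slope Θ κ (vec d) - slope Θ κ (vec e) : ℝ) : EReal)}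

/-! ### Representations and expanders -/

/-- A finite-dimensional representation of the quiver `Q` over the field `F`. -/
structure Rep.{u, v, w, x} (F : Type u) [Field F] (Q : Type v) [Quiver.{w} Q] where
  /-- the vector space at a vertex -/
  space : Q → Type x
  [addCommGroup : ∀ i, AddCommGroup (space i)]
  [module : ∀ i, Module F (space i)]
  [finite : ∀ i, FiniteDimensional F (space i)]
  /-- the linear map along an arrow -/
  map : ∀ {i j : Q}, (i ⟶ j) → space i →ₗ[F] space j

attribute [instance] Rep.addCommGroup Rep.module Rep.finite

/-- A subrepresentation: subspaces preserved by all structure maps. -/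
structure Subrep {F : Type*} [Field F] {Q : Type*} [Quiver Q] (V : Rep F Q) where
  /-- the subspace at a vertex -/
  carrier : ∀ i, Submodule F (V.space i)
  map_mem : ∀ {i j : Q} (α : i ⟶ j) (x : V.space i), x ∈ carrier i → V.map α x ∈ carrier j

/-- The dimension vector of a representation. -/
def Rep.dimVec {F : Type*} [Field F] {Q : Type*} [Quiver Q] (V : Rep F Q) : Q → ℕ :=
  fun i => Module.finrank F (V.space i)

/-- The dimension vector of a subrepresentation. -/
def Subrep.dimVec {F : Type*} [Field F] {Q : Type*} [Quiver Q] {V : Rep F Q}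
    (U : Subrep V) : Q → ℕ :=
  fun i => Module.finrank F (U.carrier i)

/-- A subrepresentation is non-zero if one of its subspaces is. -/
def Subrep.IsNonzero {F : Type*} [Field F] {Q : Type*} [Quiver Q] {V : Rep F Q}
    (U : Subrep V) : Prop :=
  ∃ i, U.carrier i ≠ ⊥

/-- `V` is a `(δ, ε)`-expander with respect to `μ = Θ / κ`: every non-zero subrepresentation
`U` with `κ(U) ≤ δ κ(V)` satisfies `μ(U) < μ(V) - ε`. -/
def IsExpander {F : Type*} [Field F] {Q : Type*} [Quiver Q]
    (Θ κ : Module.Dual ℝ (Q → ℝ)) (δ ε : ℝ) (V : Rep F Q) : Prop :=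
  ∀ U : Subrep V, U.IsNonzero → κ (vec U.dimVec) ≤ δ * κ (vec V.dimVec) →
    slope Θ κ (vec U.dimVec) < slope Θ κ (vec V.dimVec) - ε

/-- A sequence of representations (indexed by `k ≥ 1`) is unbounded if every natural number is
bounded above by the total dimension of some member. -/
def IsUnbounded {F : Type*} [Field F] {Q : Type*} [Quiver Q] [Fintype Q]
    (V : ℕ+ → Rep F Q) : Prop :=
  ∀ N : ℕ, ∃ k, N ≤ ∑ i, (V k).dimVec i

/-- An unbounded sequence of representations is a uniform expander if for all `0 < δ < 1`
there is `ε > 0` such that every member is a `(δ, ε)`-expander. -/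
def IsUniformExpander {F : Type*} [Field F] {Q : Type*} [Quiver Q] [Fintype Q]
    (Θ κ : Module.Dual ℝ (Q → ℝ)) (V : ℕ+ → Rep F Q) : Prop :=
  IsUnbounded V ∧
    ∀ δ : ℝ, 0 < δ → δ < 1 → ∃ ε : ℝ, 0 < ε ∧ ∀ k, IsExpander Θ κ δ ε (V k)

/-- A sequence of dimension vectors supports a uniform expander (over `F`) if some uniform
expander has these dimension vectors. -/
def SupportsUniformExpander.{u, v, w} (F : Type u) [Field F] {Q : Type v} [Quiver.{w} Q]
    [Fintype Q] (Θ κ : Module.Dual ℝ (Q → ℝ)) (D : ℕ+ → Q → ℕ) : Prop :=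
  ∃ V : ℕ+ → Rep.{u, v, w, u} F Q, IsUniformExpander Θ κ V ∧ ∀ k, (V k).dimVec = D k

end QuiverExpander

end

/-! ### Strict minimality of the symmetric form at a fundamental vector. -/

noncomputable section

namespace QuiverExpander

section Form

variable {ι : Type*} [Fintype ι] [DecidableEq ι] {B : LinearMap.BilinForm ℝ (ι → ℝ)}

/-! Write `B` for the symmetrized Euler form. Its off-diagonal entries are nonpositive and `B d i <
0` for all `i`, so `d` is the unique minimizer of `B x x` on the box `[0, d]`; connectedness extends
this to `|x| ≤ d` up to the sign of `d` (`form_self_lt`). At `x = 2e - d` it says `B e (d - e) < 0`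
for `0 ≤ e ≤ d`, `e ≠ 0, d`, and compactness with a linear estimate at the two corners yields
`exists_form_sub_le`.

If `⟨e, d - e⟩ ≥ 0`, then `Θ(e) = (d, e) - 2⟨e, d⟩ ≤ (e, d - e)`, so that estimate bounds `μ(e)` by
`-C κ(d - e) / κ(d) ≤ -C (1 - δ)`, while `μ(d) = 0`.

For the expander, count dimensions: representations of dimension `D` with a subrepresentation of
dimension `e` are covered by images of affine spaces whose dimension exceeds that of the
representation space by `⟨e, D - e⟩`. Over an infinite field some representation avoids all images
with negative excess. For `D = k d`, rescaling by `1/k` gives real vectors in `[0, d]`, so one bound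
serves every `k`. -/

theorem dual_apply_eq_sum (f : Module.Dual ℝ (ι → ℝ)) (x : ι → ℝ) :
    f x = ∑ i, x i * f (Pi.single i 1) := by
  conv_lhs => rw [pi_eq_sum_univ' x]
  simp only [map_sum, map_smul, smul_eq_mul]

theorem form_apply_eq_sum (x y : ι → ℝ) :
    B x y = ∑ i, ∑ j, B (Pi.single i 1) (Pi.single j 1) * (x i * y j) := by
  rw [← LinearMap.flip_apply, dual_apply_eq_sum]
  refine Finset.sum_congr rfl fun i _ => ?_
  rw [LinearMap.flip_apply, dual_apply_eq_sum, Finset.mul_sum]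
  exact Finset.sum_congr rfl fun j _ => by ring

theorem continuous_form_apply {X : Type*} [TopologicalSpace X] {f g : X → ι → ℝ}
    (hf : Continuous f) (hg : Continuous g) : Continuous fun x => B (f x) (g x) := by
  refine Continuous.congr (f := fun x => ∑ i, ∑ j,
    B (Pi.single i 1) (Pi.single j 1) * (f x i * g x j)) (by fun_prop) fun x =>
      (form_apply_eq_sum _ _).symm

/-- A minimizer `x` of `B x x` over a box with lower corner `0`
satisfies `B x i ≤ 0` for all `i`. -/
theorem form_single_nonpos_of_isMinOn (hsymm : ∀ x y, B x y = B y x)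
    (hoff : ∀ i j, i ≠ j → B (Pi.single i 1) (Pi.single j 1) ≤ 0)
    {d x : ι → ℝ} (hx : x ∈ Set.Icc 0 d) (hmin : ∀ y ∈ Set.Icc 0 d, B x x ≤ B y y) (i : ι) :
    B x (Pi.single i 1) ≤ 0 := by
  by_cases hxi : x i = 0
  · rw [hsymm, dual_apply_eq_sum]
    refine Finset.sum_nonpos fun j _ => ?_
    by_cases hij : i = j
    · subst hij; simp [hxi]
    · exact mul_nonpos_of_nonneg_of_nonpos (hx.1 j) (hoff i j hij)
  · have hpos : 0 < x i := lt_of_le_of_ne (hx.1 i) (Ne.symm hxi)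
    by_contra! hcon
    set b := B x (Pi.single i 1)
    set a := B (Pi.single i 1) (Pi.single i 1)
    -- `s ≤ x i` keeps the shifted point in the box; `s (|a| + 1) ≤ b` makes `-2sb + s²a` negative.
    let s := min (x i) (b / (|a| + 1))
    have hs : 0 < s := lt_min hpos (by positivity)
    have hsx : s ≤ x i := min_le_left _ _
    have hsb : s * (|a| + 1) ≤ b := (le_div_iff₀ (by positivity)).1 (min_le_right _ _)
    have hmem : x - s • Pi.single i 1 ∈ Set.Icc 0 d := by
      refine ⟨fun j => ?_, fun j => ?_⟩ <;> by_cases hij : j = i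
      · subst hij; simpa using hsx
      · simpa [hij] using hx.1 j
      · subst hij
        have := hx.2 j
        simp only [Pi.sub_apply, Pi.smul_apply, Pi.single_eq_same, smul_eq_mul]
        linarith
      · simpa [hij] using hx.2 j
    have hle := hmin _ hmem
    have hexp : B (x - s • Pi.single i 1) (x - s • Pi.single i 1) =
        B x x - 2 * s * b + s * s * a := by
      simp only [map_sub, map_smul, LinearMap.sub_apply, LinearMap.smul_apply, smul_eq_mul,
        hsymm (Pi.single i 1) x]
      ring
    rw [hexp] at hle
    have h1 : s * a ≤ s * |a| := mul_le_mul_of_nonneg_left (le_abs_self a) hs.le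
    nlinarith

/-- For a minimizer `z`, `B d d - B z z = B d (d - z) + B z (d - z)`: the second term is nonpositive
by the first-order condition, the first negative unless `z = d`. A minimizer exists by compactness,
so it is `d`. -/
theorem form_self_lt_of_mem_Icc (hsymm : ∀ x y, B x y = B y x)
    (hoff : ∀ i j, i ≠ j → B (Pi.single i 1) (Pi.single j 1) ≤ 0)
    {d : ι → ℝ} (hd0 : 0 ≤ d) (hd : ∀ i, B d (Pi.single i 1) < 0)
    {x : ι → ℝ} (hx : x ∈ Set.Icc 0 d) (hxd : x ≠ d) : B d d < B x x := by
  have key : ∀ z ∈ Set.Icc 0 d, (∀ y ∈ Set.Icc 0 d, B z z ≤ B y y) → z ≠ d → B d d < B z z := by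
    intro z hz hmin hzd
    have h1 : B d d - B z z = B d (d - z) + B z (d - z) := by
      simp only [map_sub]
      rw [hsymm z d]
      ring
    have h2 : B z (d - z) ≤ 0 := by
      rw [dual_apply_eq_sum]
      exact Finset.sum_nonpos fun i _ => mul_nonpos_of_nonneg_of_nonpos
        (sub_nonneg.2 (hz.2 i)) (form_single_nonpos_of_isMinOn hsymm hoff hz hmin i)
    have h3 : B d (d - z) < 0 := by
      obtain ⟨i, hi⟩ := Function.ne_iff.1 hzd
      rw [dual_apply_eq_sum]
      refine Finset.sum_neg' (fun j _ => mul_nonpos_of_nonneg_of_nonpos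
        (sub_nonneg.2 (hz.2 j)) (hd j).le) ⟨i, Finset.mem_univ i, ?_⟩
      exact mul_neg_of_pos_of_neg (sub_pos.2 (lt_of_le_of_ne (hz.2 i) hi)) (hd i)
    linarith
  obtain ⟨z, hz, hzmin⟩ := (isCompact_Icc (a := (0 : ι → ℝ)) (b := d)).exists_isMinOn
    ⟨0, le_rfl, hd0⟩ (continuous_form_apply (B := B) continuous_id continuous_id).continuousOn
  have hzmin' : ∀ y ∈ Set.Icc 0 d, B z z ≤ B y y := fun y hy => hzmin hy
  have hzd : z = d := by
    by_contra hne
    exact absurd (key z hz hzmin' hne) (not_lt.2 (hzmin' d ⟨hd0, le_rfl⟩))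
  subst hzd
  by_cases hmin : ∀ y ∈ Set.Icc 0 z, B x x ≤ B y y
  · exact key x hx hmin hxd
  · push Not at hmin
    obtain ⟨y, hy, hlt⟩ := hmin
    exact (hzmin' y hy).trans_lt hlt

/-- The comparison holds term by term; equality of the sums forces it in each term, so neighbours
with nonzero coordinates share a sign. -/
theorem form_abs_le (hoff : ∀ i j, i ≠ j → B (Pi.single i 1) (Pi.single j 1) ≤ 0)
    (x : ι → ℝ) : B |x| |x| ≤ B x x ∧ (B x x = B |x| |x| →
      ∀ i j, i ≠ j → B (Pi.single i 1) (Pi.single j 1) < 0 → x i * x j = |x i| * |x j|) := by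
  have hterm : ∀ i j, B (Pi.single i 1) (Pi.single j 1) * (|x| i * |x| j) ≤
      B (Pi.single i 1) (Pi.single j 1) * (x i * x j) := by
    intro i j
    by_cases hij : i = j
    · subst hij; simp
    · refine mul_le_mul_of_nonpos_left ?_ (hoff i j hij)
      simpa [abs_mul] using le_abs_self (x i * x j)
  rw [form_apply_eq_sum |x|, form_apply_eq_sum x]
  refine ⟨Finset.sum_le_sum fun i _ => Finset.sum_le_sum fun j _ => hterm i j, ?_⟩
  intro heq i j _ hneg
  have h1 := (Finset.sum_eq_sum_iff_of_le fun i _ =>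
    Finset.sum_le_sum fun j _ => hterm i j).1 heq.symm i (Finset.mem_univ i)
  have h2 := (Finset.sum_eq_sum_iff_of_le fun j _ => hterm i j).1 h1 j (Finset.mem_univ j)
  exact (mul_left_cancel₀ hneg.ne h2).symm

/-- Hypotheses on a form and a vector which hold for the Cartan form of a connected acyclic quiver
and a vector in the interior of the fundamental domain. -/
structure IsStrictlyFundamental (B : LinearMap.BilinForm ℝ (ι → ℝ)) (d : ι → ℝ) : Prop where
  symm : ∀ x y, B x y = B y x
  off_diag : ∀ i j, i ≠ j → B (Pi.single i 1) (Pi.single j 1) ≤ 0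
  connected : ∀ p : ι → Prop,
    (∀ i j, i ≠ j → B (Pi.single i 1) (Pi.single j 1) < 0 → p i → p j) → ∀ i j, p i → p j
  pos : ∀ i, 0 < d i
  neg : ∀ i, B d (Pi.single i 1) < 0
  nonempty : Nonempty ι

namespace IsStrictlyFundamental

variable {d : ι → ℝ}

theorem form_self_lt (h : IsStrictlyFundamental B d) {x : ι → ℝ} (hx : |x| ≤ d)
    (h1 : x ≠ d) (h2 : x ≠ -d) : B d d < B x x := by
  have hd0 : 0 ≤ d := fun i => (h.pos i).le
  obtain ⟨hle, heq⟩ := form_abs_le h.off_diag x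
  by_cases habs : |x| = d
  · refine lt_of_le_of_ne (habs ▸ hle) fun hcon => ?_
    have hsign := heq (by rw [habs, hcon])
    have hxi : ∀ i, |x i| = d i := fun i => congrFun habs i
    -- Positivity spreads along edges, so `x` has constant sign and is `d` or `-d`.
    have hconn := h.connected (fun i => 0 < x i) fun i j hij hneg hi => by
      have := hsign i j hij hneg
      rw [hxi, hxi] at this
      have hpos := mul_pos (h.pos i) (h.pos j)
      rw [← this] at hpos
      exact (mul_pos_iff_of_pos_left hi).1 hpos
    by_cases hp : ∃ i, 0 < x i
    · obtain ⟨i, hi⟩ := hp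
      exact h1 (funext fun j => by rw [← hxi j, abs_of_pos (hconn i j hi)])
    · push Not at hp
      exact h2 (funext fun j => by rw [Pi.neg_apply, ← hxi j, abs_of_nonpos (hp j), neg_neg])
  · exact (form_self_lt_of_mem_Icc h.symm h.off_diag hd0 h.neg ⟨abs_nonneg x, hx⟩ habs).trans_le hle

/-- With `x = 2e - d` one has `B x x - B d d = -4 B e (d - e)`, and `|x| ≤ d`. -/
theorem form_sub_neg (h : IsStrictlyFundamental B d) {e : ι → ℝ} (he : e ∈ Set.Icc 0 d)
    (h0 : e ≠ 0) (h1 : e ≠ d) : B e (d - e) < 0 := by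
  have hlt : B d d < B (e + e - d) (e + e - d) := by
    refine h.form_self_lt (fun i => ?_) (fun hc => h1 ?_) (fun hc => h0 ?_)
    · have := he.1 i
      have := he.2 i
      simp only [Pi.zero_apply] at *
      exact abs_le.2 ⟨by simp; linarith, by simp; linarith⟩
    · ext i
      have := congrFun hc i
      simp at this
      linarith
    · ext i
      have := congrFun hc i
      simp at this
      simp [this]
  simp only [map_sub, map_add, LinearMap.sub_apply, LinearMap.add_apply, h.symm d e] at hlt ⊢
  linarith

theorem form_nonpos (h : IsStrictlyFundamental B d) {e : ι → ℝ} (he : 0 ≤ e) : B d e ≤ 0 := by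
  rw [dual_apply_eq_sum]
  exact Finset.sum_nonpos fun i _ => mul_nonpos_of_nonneg_of_nonpos (he i) (h.neg i).le

theorem form_neg (h : IsStrictlyFundamental B d) {e : ι → ℝ} (he : 0 ≤ e) (h0 : e ≠ 0) :
    B d e < 0 := by
  obtain ⟨i, hi⟩ := Function.ne_iff.1 h0
  rw [dual_apply_eq_sum]
  exact Finset.sum_neg' (fun i _ => mul_nonpos_of_nonneg_of_nonpos (he i) (h.neg i).le)
    ⟨i, Finset.mem_univ i, mul_neg_of_pos_of_neg (lt_of_le_of_ne (he i) (Ne.symm hi)) (h.neg i)⟩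

theorem ne_zero (h : IsStrictlyFundamental B d) : d ≠ 0 := fun hc => by
  obtain ⟨i⟩ := h.nonempty
  exact (h.pos i).ne' (congrFun hc i)

theorem form_self_neg (h : IsStrictlyFundamental B d) : B d d < 0 :=
  h.form_neg (fun i => (h.pos i).le) h.ne_zero

/-- Close to the origin `B e (d - e)` is controlled by its linear part `B d e`. -/
theorem exists_form_sub_le_half (h : IsStrictlyFundamental B d) :
    ∃ s : ℝ, 0 < s ∧ ∀ e : ι → ℝ, 0 ≤ e → e ≤ s • d → B e (d - e) ≤ B d e / 2 := by
  have hK : ∃ K : ℝ, 0 ≤ K ∧ ∀ i,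
      |B (Pi.single i 1) (Pi.single i 1)| * d i ≤ K * -B d (Pi.single i 1) := by
    have hnn : ∀ i, 0 ≤ |B (Pi.single i 1) (Pi.single i 1)| * d i / -B d (Pi.single i 1) :=
      fun i => div_nonneg (mul_nonneg (abs_nonneg _) (h.pos i).le) (neg_pos.2 (h.neg i)).le
    refine ⟨∑ i, |B (Pi.single i 1) (Pi.single i 1)| * d i / -B d (Pi.single i 1),
      Finset.sum_nonneg fun i _ => hnn i, fun i => ?_⟩
    rw [← div_le_iff₀ (neg_pos.2 (h.neg i))]
    exact Finset.single_le_sum (fun j _ => hnn j) (Finset.mem_univ i)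
  obtain ⟨K, hK0, hK⟩ := hK
  refine ⟨1 / (2 * (1 + K)), by positivity, fun e he hes => ?_⟩
  set s := 1 / (2 * (1 + K)) with hs
  have hspos : 0 < s := by positivity
  have hsK : s * (1 + K) = 1 / 2 := by rw [hs]; field_simp
  -- Off the diagonal `e ≤ s d` gives the bound with factor `s`; the diagonal term costs at most `s
  -- K` times `-B d i`.
  have hrow : ∀ i, s * (1 + K) * B d (Pi.single i 1) ≤ B e (Pi.single i 1) := by
    intro i
    have hle : ∀ j, e j * B (Pi.single i 1) (Pi.single j 1) ≥
        s * (d j * B (Pi.single i 1) (Pi.single j 1)) -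
          (if j = i then s * (|B (Pi.single i 1) (Pi.single i 1)| * d i) else 0) := by
      intro j
      have hej : e j ≤ s * d j := hes j
      by_cases hji : j = i
      · subst hji
        set a := B (Pi.single j 1) (Pi.single j 1)
        simp only [if_true]
        have h1 : 0 ≤ e j := he j
        have h2 := h.pos j
        rcases le_total 0 a with ha | ha
        · rw [abs_of_nonneg ha]
          nlinarith [mul_nonneg h1 ha]
        · have h3 : 0 ≤ s * (|a| * d j) := by positivity
          have h4 : s * d j * a ≤ e j * a := mul_le_mul_of_nonpos_right hej ha
          linarith
      · simp only [if_neg hji, sub_zero]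
        have := mul_le_mul_of_nonpos_right hej (h.off_diag i j (Ne.symm hji))
        linarith
    have hsum := Finset.sum_le_sum fun j (_ : j ∈ Finset.univ) => hle j
    rw [Finset.sum_sub_distrib, ← Finset.mul_sum, ← dual_apply_eq_sum, ← dual_apply_eq_sum,
      h.symm _ d, h.symm _ e, Finset.sum_ite_eq' Finset.univ i] at hsum
    simp only [Finset.mem_univ, if_true] at hsum
    have := mul_le_mul_of_nonneg_left (hK i) hspos.le
    nlinarith
  have hee : B d e / 2 ≤ B e e := by
    rw [dual_apply_eq_sum (B e), dual_apply_eq_sum (B d), Finset.sum_div]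
    refine Finset.sum_le_sum fun i _ => ?_
    have := mul_le_mul_of_nonneg_left (hrow i) (he i)
    rw [hsK] at this
    linarith
  rw [map_sub, h.symm e d]
  linarith

/-- Both sides vanish at `e = 0` and `e = d`, so compactness alone gives no constant. Near `0` the
linear part decides, near `d` the symmetry `e ↦ d - e` applies, and the remaining region is compact
with `B e (d - e)` negative. -/
theorem exists_form_sub_le (h : IsStrictlyFundamental B d) :
    ∃ C : ℝ, 0 < C ∧ ∀ e ∈ Set.Icc 0 d, B e (d - e) * -B d d ≤ -(C * (B d e * B d (d - e))) := by
  obtain ⟨s, hs, hnear⟩ := h.exists_form_sub_le_half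
  have hdd := h.form_self_neg
  have hdec : ∀ e, B d d = B d e + B d (d - e) := fun e => by rw [map_sub]; ring
  have hhalf : ∀ e ∈ Set.Icc 0 d, e ≤ s • d →
      B e (d - e) * -B d d ≤ -(1 / 2 * (B d e * B d (d - e))) := by
    intro e he hes
    have h1 := h.form_nonpos he.1
    have h2 := h.form_nonpos (sub_nonneg.2 he.2)
    have h3 := mul_le_mul_of_nonneg_right (hnear e he.1 hes) (neg_pos.2 hdd).le
    have h4 := hdec e
    nlinarith [mul_self_nonneg (B d e)]
  let S : Set (ι → ℝ) := Set.Icc 0 d ∩ ((⋃ i, {e | s * d i ≤ e i}) ∩ ⋃ i, {e | s * d i ≤ d i - e i})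
  have hS : IsCompact S := by
    refine isCompact_Icc.inter_right (IsClosed.inter ?_ ?_) <;>
      exact isClosed_iUnion_of_finite fun i => isClosed_le (by fun_prop) (by fun_prop)
  have hmid : ∃ c : ℝ, 0 < c ∧ ∀ e ∈ S, B e (d - e) ≤ -c := by
    rcases S.eq_empty_or_nonempty with hempty | hne
    · exact ⟨1, one_pos, fun e he => by simp [hempty] at he⟩
    · obtain ⟨z, hz, hmax⟩ := hS.exists_isMaxOn hne (f := fun e => B e (d - e))
        (continuous_form_apply continuous_id (by fun_prop)).continuousOn
      refine ⟨-B z (d - z), neg_pos.2 (h.form_sub_neg hz.1 ?_ ?_), fun e he => ?_⟩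
      · rintro rfl
        obtain ⟨i, hi⟩ := Set.mem_iUnion.1 hz.2.1
        have : 0 < s * d i := mul_pos hs (h.pos i)
        simp at hi
        linarith
      · rintro rfl
        obtain ⟨i, hi⟩ := Set.mem_iUnion.1 hz.2.2
        have : 0 < s * z i := mul_pos hs (h.pos i)
        simp at hi
        linarith
      · rw [neg_neg]; exact hmax he
  obtain ⟨c, hc, hmid⟩ := hmid
  have hmono : ∀ C C' : ℝ, C ≤ C' → ∀ e ∈ Set.Icc 0 d,
      -(C' * (B d e * B d (d - e))) ≤ -(C * (B d e * B d (d - e))) := fun C C' hCC' e he =>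
    neg_le_neg (mul_le_mul_of_nonneg_right hCC' (mul_nonneg_of_nonpos_of_nonpos
      (h.form_nonpos he.1) (h.form_nonpos (sub_nonneg.2 he.2))))
  -- `1/2` serves the corners; `c / -B d d` serves the middle, where `B d e * B d (d - e) ≤ (B d
  -- d)²`.
  refine ⟨min (1 / 2) (c / -B d d), lt_min (by norm_num) (div_pos hc (neg_pos.2 hdd)),
    fun e he => ?_⟩
  by_cases h1 : e ≤ s • d
  · exact (hhalf e he h1).trans (hmono _ _ (min_le_left _ _) e he)
  by_cases h2 : d - e ≤ s • d
  · have := hhalf (d - e) ⟨sub_nonneg.2 he.2, by simpa using he.1⟩ h2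
    rw [sub_sub_cancel, h.symm, mul_comm (B d (d - e))] at this
    exact this.trans (hmono _ _ (min_le_left _ _) e he)
  · have heS : e ∈ S := by
      simp only [Pi.le_def, not_forall, not_le] at h1 h2
      obtain ⟨i, hi⟩ := h1
      obtain ⟨j, hj⟩ := h2
      exact ⟨he, Set.mem_iUnion.2 ⟨i, hi.le⟩, Set.mem_iUnion.2 ⟨j, hj.le⟩⟩
    refine le_trans ?_ (hmono _ _ (min_le_right _ _) e he)
    have h3 := h.form_nonpos he.1
    have h4 := h.form_nonpos (sub_nonneg.2 he.2)
    have h5 := hdec e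
    have h6 := mul_le_mul_of_nonneg_right (hmid e heS) (neg_pos.2 hdd).le
    have h7 : B d e * B d (d - e) ≤ B d d * B d d := by
      rw [h5]; nlinarith [mul_nonneg_of_nonpos_of_nonpos h3 h4, mul_self_nonneg (B d e),
        mul_self_nonneg (B d (d - e))]
    have h8 : c / -B d d * (B d e * B d (d - e)) ≤ c / -B d d * (B d d * B d d) :=
      mul_le_mul_of_nonneg_left h7 (div_pos hc (neg_pos.2 hdd)).le
    have h9 : c / -B d d * (B d d * B d d) = c * -B d d := by field_simp
    linarith

end IsStrictlyFundamental

end Form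

end QuiverExpander

end

/-! ### Polynomial images of small dimension, and charts of Grassmannians. -/

noncomputable section

namespace QuiverExpander

open MvPolynomial Matrix

/-- Polynomials in fewer variables are algebraically dependent. -/
theorem exists_aeval_eq_zero_of_card_lt {F σ τ : Type*} [Field F] [Fintype σ] [Fintype τ]
    (hcard : Fintype.card σ < Fintype.card τ) (p : τ → MvPolynomial σ F) :
    ∃ f : MvPolynomial τ F, f ≠ 0 ∧ aeval p f = 0 := by
  have hdep : ¬ AlgebraicIndependent F p := fun hind => by
    have h := hind.lift_cardinalMk_le_trdeg
    rw [MvPolynomial.trdeg_of_isDomain] at h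
    simp only [Cardinal.mk_fintype, Cardinal.lift_natCast, Nat.cast_le] at h
    omega
  rw [AlgebraicIndependent, injective_iff_map_eq_zero] at hdep
  push Not at hdep
  obtain ⟨f, hf, hf0⟩ := hdep
  exact ⟨f, hf0, hf⟩

/-- Over an infinite field, the images of finitely many polynomial maps from affine spaces of
smaller dimension do not cover an affine space. -/
theorem exists_forall_ne_eval {F τ κ : Type*} [Field F] [Infinite F] [Fintype τ] [Finite κ]
    (σ : κ → Type*) [∀ k, Fintype (σ k)] (hcard : ∀ k, Fintype.card (σ k) < Fintype.card τ)
    (p : ∀ k, τ → MvPolynomial (σ k) F) :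
    ∃ v : τ → F, ∀ k (w : σ k → F), v ≠ fun t => eval w (p k t) := by
  cases nonempty_fintype κ
  choose f hf0 hf using fun k => exists_aeval_eq_zero_of_card_lt (hcard k) (p k)
  -- Each image lies in the hypersurface `f k = 0`; a point off their union suffices.
  have hprod : ∏ k, f k ≠ 0 := Finset.prod_ne_zero_iff.2 fun k _ => hf0 k
  obtain ⟨v, hv⟩ : ∃ v, eval v (∏ k, f k) ≠ 0 := by
    by_contra! hcon
    exact hprod (MvPolynomial.funext fun v => by rw [hcon, map_zero])
  rw [map_prod, Finset.prod_ne_zero_iff] at hv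
  refine ⟨v, fun k w hvw => hv k (Finset.mem_univ k) ?_⟩
  have := congrArg (eval w) (hf k)
  rw [map_zero, aeval_def, MvPolynomial.algebraMap_eq, eval_eval₂] at this
  rw [hvw, eval, coe_eval₂Hom]
  convert this using 2
  ext; simp

/-- Every subspace of `F^ι` is the graph of a linear map `F^S → F^Sᶜ` for some `S`. -/
theorem exists_graph_chart {F ι : Type*} [Field F] [Fintype ι] [DecidableEq ι]
    (U : Submodule F (ι → F)) :
    ∃ (S : Finset ι) (N : Matrix ι ι F), S.card = Module.finrank F U ∧
      (∀ t s, ¬(t ∉ S ∧ s ∈ S) → N t s = 0) ∧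
      (∀ s ∈ S, (1 + N).col s ∈ U) ∧
      ∀ u ∈ U, ∀ t ∉ S, u t = (N *ᵥ u) t := by
  let v : ι → Module.Dual F U := fun i => (LinearMap.proj i).comp U.subtype
  -- A maximal independent set of coordinate functionals on `U` indexes `S`; `b` below is the dual
  -- basis.
  obtain ⟨κ, a, ha, hspan, hli⟩ := exists_linearIndependent' F v
  have : Finite κ := Finite.of_injective a ha
  cases nonempty_fintype κ
  let r : U →ₗ[F] κ → F := LinearMap.pi fun k => v (a k)
  have hcoord : ∀ i, ∀ u : U, r u = 0 → (u : ι → F) i = 0 := by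
    intro i u hu
    have hi : v i ∈ Submodule.span F (Set.range (v ∘ a)) := by
      rw [hspan]; exact Submodule.subset_span ⟨i, rfl⟩
    have hle : Submodule.span F (Set.range (v ∘ a)) ≤
        LinearMap.ker (LinearMap.applyₗ (R := F) (M₂ := F) u) := by
      rw [Submodule.span_le]
      rintro _ ⟨k, rfl⟩
      exact congrFun hu k
    exact hle hi
  have hinj : Function.Injective r := by
    rw [injective_iff_map_eq_zero]
    exact fun u hu => Subtype.ext (funext fun i => hcoord i u hu)
  have hcard : Module.finrank F U = Fintype.card κ := by
    refine le_antisymm ?_ ?_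
    · simpa using LinearMap.finrank_le_finrank_of_injective hinj
    · rw [← Subspace.dual_finrank_eq]
      exact hli.fintype_card_le_finrank
  have hbij : Function.Bijective r :=
    ⟨hinj, (LinearMap.injective_iff_surjective_of_finrank_eq_finrank (by simpa using hcard)).1 hinj⟩
  let R : U ≃ₗ[F] κ → F := LinearEquiv.ofBijective r hbij
  classical
  let b : ι → U := fun s => R.symm fun k => if a k = s then 1 else 0
  have hb : ∀ s k, (b s : ι → F) (a k) = if a k = s then 1 else 0 := fun s k =>
    congrFun (R.apply_symm_apply fun k => if a k = s then (1 : F) else 0) k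
  let S : Finset ι := Finset.univ.map ⟨a, ha⟩
  have hS : ∀ s, s ∈ S ↔ ∃ k, a k = s := by simp [S]
  have hexp : ∀ u : U, u = ∑ s ∈ S, (u : ι → F) s • b s := by
    intro u
    apply hinj
    ext k
    have : ∀ w : U, r w k = (w : ι → F) (a k) := fun w => rfl
    rw [this, this]
    simp [Finset.sum_apply, hb, S, ha.eq_iff]
  refine ⟨S, Matrix.of fun t s => if t ∉ S ∧ s ∈ S then (b s : ι → F) t else 0, ?_, ?_, ?_, ?_⟩
  · simp [S, hcard]
  · intro t s hts
    simp only [Matrix.of_apply, if_neg hts]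
  · intro s hs
    convert (b s).2 using 1
    ext t
    by_cases ht : t ∈ S
    · obtain ⟨k, rfl⟩ := (hS t).1 ht
      simp [hb, ht, Matrix.one_apply]
    · have : t ≠ s := fun h => ht (h ▸ hs)
      simp [ht, hs, this]
  · intro u hu t ht
    have := congrArg (fun w : U => (w : ι → F) t) (hexp ⟨u, hu⟩)
    simp only [Submodule.coe_sum, Submodule.coe_smul, Finset.sum_apply, Pi.smul_apply,
      smul_eq_mul] at this
    rw [this, Matrix.mulVec, dotProduct, ← Finset.sum_subset (Finset.subset_univ S)]
    · exact Finset.sum_congr rfl fun s hs => by simp [ht, hs, mul_comm]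
    · intro s _ hs
      simp [hs]

end QuiverExpander

end

/-! ### Dimension count for representations with a subrepresentation. -/

noncomputable section

namespace QuiverExpander

open MvPolynomial Matrix

section Chart

variable {Q : Type*} [Quiver Q] {D : Q → ℕ}

/-- The coordinates of the space of representations of dimension vector `D`: the entries of
the matrices along the arrows. -/
abbrev MatIndex (D : Q → ℕ) := Σ (i : Q) (j : Q) (_ : i ⟶ j), Fin (D j) × Fin (D i)

/-- The coordinates of the space of representations preserving the coordinate subspaces given
by `S`. -/
abbrev BlockIndex (S : ∀ i, Finset (Fin (D i))) :=
  {x : MatIndex D // ¬(x.2.2.2.1 ∉ S x.2.1 ∧ x.2.2.2.2 ∈ S x.1)}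

/-- The coordinates of the chart of the product of Grassmannians given by `S`. -/
abbrev GrassIndex (S : ∀ i, Finset (Fin (D i))) := Σ i, {t // t ∉ S i} × {s // s ∈ S i}

/-- The nilpotent matrix which defines the point of the Grassmannian chart with coordinates `w`. -/
def nilMatrix {R : Type*} [CommRing R] (S : ∀ i, Finset (Fin (D i))) (w : GrassIndex S → R)
    (i : Q) : Matrix (Fin (D i)) (Fin (D i)) R :=
  Matrix.of fun t s => if h : t ∉ S i ∧ s ∈ S i then w ⟨i, ⟨t, h.1⟩, ⟨s, h.2⟩⟩ else 0

/-- The matrix along an arrow of the representation with coordinates `w` which preserves the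
coordinate subspaces given by `S`. -/
def blockMatrix {R : Type*} [CommRing R] (S : ∀ i, Finset (Fin (D i))) (w : BlockIndex S → R)
    {i j : Q} (α : i ⟶ j) : Matrix (Fin (D j)) (Fin (D i)) R :=
  Matrix.of fun t s => if h : ¬(t ∉ S j ∧ s ∈ S i) then w ⟨⟨i, j, α, t, s⟩, h⟩ else 0

/-- The parametrization of the representations which have a subrepresentation in the chart
of the product of Grassmannians given by `S`. -/
def chartMap {R : Type*} [CommRing R] (S : ∀ i, Finset (Fin (D i)))
    (w : BlockIndex S ⊕ GrassIndex S → R) (x : MatIndex D) : R :=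
  ((1 + nilMatrix S (w ∘ Sum.inr) x.2.1) * blockMatrix S (w ∘ Sum.inl) x.2.2.1 *
    (1 - nilMatrix S (w ∘ Sum.inr) x.1) : Matrix (Fin (D x.2.1)) (Fin (D x.1)) R)
      x.2.2.2.1 x.2.2.2.2

/-- Naturality in the ring lets one formula give both the polynomials (at `w = X`) and their values.
-/
theorem map_chartMap {R R' : Type*} [CommRing R] [CommRing R'] (φ : R →+* R')
    (S : ∀ i, Finset (Fin (D i))) (w : BlockIndex S ⊕ GrassIndex S → R) (x : MatIndex D) :
    φ (chartMap S w x) = chartMap S (φ ∘ w) x := by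
  have hnil : ∀ i, (nilMatrix S (w ∘ Sum.inr) i).map φ = nilMatrix S ((φ ∘ w) ∘ Sum.inr) i := by
    intro i
    ext t s
    simp only [nilMatrix, Matrix.map_apply, Matrix.of_apply]
    split_ifs <;> simp
  have hblock : ∀ {i j : Q} (α : i ⟶ j),
      (blockMatrix S (w ∘ Sum.inl) α).map φ = blockMatrix S ((φ ∘ w) ∘ Sum.inl) α := by
    intro i j α
    ext t s
    simp only [blockMatrix, Matrix.map_apply, Matrix.of_apply]
    split_ifs <;> simp
  have hone : ∀ i, (1 : Matrix (Fin (D i)) (Fin (D i)) R).map φ = 1 := fun i =>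
    Matrix.map_one φ φ.map_zero φ.map_one
  rw [chartMap, RingHom.map_matrix_mul, Matrix.map_mul, Matrix.map_add φ φ.map_add,
    Matrix.map_sub φ φ.map_sub, hone, hone, hnil, hnil, hblock, chartMap]

theorem sum_ite_notMem_and_mem {m n : ℕ} (S : Finset (Fin m)) (T : Finset (Fin n)) :
    ∑ t, ∑ s, (if t ∉ S ∧ s ∈ T then (1 : ℝ) else 0) = (m - S.card) * T.card := by
  have h1 : ∀ t s, (if t ∉ S ∧ s ∈ T then (1 : ℝ) else 0) =
      (1 - if t ∈ S then 1 else 0) * if s ∈ T then 1 else 0 := by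
    intro t s
    by_cases ht : t ∈ S <;> by_cases hs : s ∈ T <;> simp [ht, hs]
  simp_rw [h1, ← Finset.mul_sum, ← Finset.sum_mul, Finset.sum_sub_distrib]
  simp

variable [Fintype Q] [∀ i j : Q, Fintype (i ⟶ j)]

theorem eulerForm_apply (x y : Q → ℝ) :
    eulerForm Q x y = ∑ i, x i * y i - ∑ i, ∑ j, ∑ _α : i ⟶ j, x i * y j := rfl

/-- The Grassmannian adds the vertex part of the Euler form; the forced zero blocks remove its arrow
part. -/
theorem card_blockIndex_add_card_grassIndex (S : ∀ i, Finset (Fin (D i))) :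
    ((Fintype.card (BlockIndex S ⊕ GrassIndex S) : ℕ) : ℝ) = Fintype.card (MatIndex D) +
      eulerForm Q (vec fun i => (S i).card) (vec D - vec fun i => (S i).card) := by
  have hblock : ((Fintype.card (BlockIndex S) : ℕ) : ℝ) = Fintype.card (MatIndex D) -
      ∑ i, ∑ j, ∑ _α : i ⟶ j, ((S i).card : ℝ) * (D j - (S j).card) := by
    rw [Fintype.card_subtype, Finset.natCast_card_filter, ← Finset.card_univ, Finset.cast_card,
      eq_sub_iff_add_eq]
    have h2 : ∑ i, ∑ j, ∑ _α : i ⟶ j, ((S i).card : ℝ) * (D j - (S j).card) =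
        ∑ x : MatIndex D, if x.2.2.2.1 ∉ S x.2.1 ∧ x.2.2.2.2 ∈ S x.1 then (1 : ℝ) else 0 := by
      simp_rw [Fintype.sum_sigma, Fintype.sum_prod_type, sum_ite_notMem_and_mem]
      simp_rw [mul_comm]
    rw [h2, ← Finset.sum_add_distrib]
    refine Finset.sum_congr rfl fun x _ => ?_
    split_ifs <;> simp_all
  have hgrass : ((Fintype.card (GrassIndex S) : ℕ) : ℝ) =
      ∑ i, ((S i).card : ℝ) * (D i - (S i).card) := by
    rw [Fintype.card_sigma, Nat.cast_sum]
    refine Finset.sum_congr rfl fun i _ => ?_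
    rw [Fintype.card_prod, Fintype.card_subtype_compl, Fintype.card_coe, Fintype.card_fin,
      Nat.cast_mul, Nat.cast_sub (by simpa using Finset.card_le_univ (S i))]
    ring
  rw [Fintype.card_sum, Nat.cast_add, hblock, hgrass, eulerForm_apply]
  simp only [vec, Pi.sub_apply]
  ring

/-- Over an infinite field there are representations of every dimension vector `D` all of whose
subrepresentations have a dimension vector `e` with `⟨e, D - e⟩ ≥ 0`. -/
theorem exists_rep_forall_subrep_eulerForm_nonneg.{u, v, w} (F : Type u) [Field F] [Infinite F]
    {Q : Type v} [Quiver.{w} Q] [Fintype Q] [∀ i j : Q, Fintype (i ⟶ j)] (D : Q → ℕ) :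
    ∃ V : Rep.{u, v, w, u} F Q, V.dimVec = D ∧ ∀ U : Subrep V, U.dimVec ≤ D ∧
      0 ≤ eulerForm Q (vec U.dimVec) (vec D - vec U.dimVec) := by
  classical
  obtain ⟨v, hv⟩ := exists_forall_ne_eval (F := F) (τ := MatIndex D)
    (κ := {S : ∀ i, Finset (Fin (D i)) //
      Fintype.card (BlockIndex S ⊕ GrassIndex S) < Fintype.card (MatIndex D)})
    (fun S => BlockIndex S.1 ⊕ GrassIndex S.1) (fun S => S.2) (fun S => chartMap S.1 X)
  let A : ∀ {i j : Q}, (i ⟶ j) → Matrix (Fin (D j)) (Fin (D i)) F := fun {i j} α =>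
    Matrix.of fun t s => v ⟨i, j, α, t, s⟩
  let V : Rep.{u, v, w, u} F Q :=
    { space := fun i => Fin (D i) → F
      map := fun α => Matrix.toLin' (A α) }
  have hVdim : V.dimVec = D := funext fun i => Module.finrank_fin_fun F
  refine ⟨V, hVdim, fun U => ⟨fun i => ?_, ?_⟩⟩
  · exact (Submodule.finrank_le (U.carrier i)).trans_eq (congrFun hVdim i)
  by_contra! hneg
  choose S N hScard hN hNmem hNcoord using fun i =>
    exists_graph_chart (F := F) (ι := Fin (D i)) (U.carrier i)
  have hdim : U.dimVec = fun i => (S i).card := funext fun i => (hScard i).symm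
  have hcard : Fintype.card (BlockIndex S ⊕ GrassIndex S) < Fintype.card (MatIndex D) := by
    have := card_blockIndex_add_card_grassIndex S
    rw [hdim] at hneg
    have h' : ((Fintype.card (BlockIndex S ⊕ GrassIndex S) : ℕ) : ℝ) <
        (Fintype.card (MatIndex D) : ℕ) := by linarith
    exact_mod_cast h'
  -- Since `1 + N i` carries the coordinate subspace of `S i` onto `U.carrier i` and has inverse `1
  -- - N i`, the matrices `W` preserve coordinate subspaces. Thus `v` lies in an excluded image.
  let W : ∀ {i j : Q}, (i ⟶ j) → Matrix (Fin (D j)) (Fin (D i)) F := fun {i j} α =>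
    (1 - N j) * A α * (1 + N i)
  let w : BlockIndex S ⊕ GrassIndex S → F := Sum.elim
    (fun x => W x.1.2.2.1 x.1.2.2.2.1 x.1.2.2.2.2) (fun y => N y.1 y.2.1 y.2.2)
  refine hv ⟨S, hcard⟩ w (funext fun x => ?_)
  rw [map_chartMap]
  have hw : (eval w) ∘ X = w := funext fun y => eval_X y
  rw [hw]
  have hnil : ∀ i, nilMatrix S (w ∘ Sum.inr) i = N i := by
    intro i
    ext t s
    simp only [nilMatrix, Matrix.of_apply]
    split_ifs with h
    · rfl
    · exact (hN i t s h).symm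
  have hNN : ∀ i, N i * N i = 0 := by
    intro i
    ext t s
    rw [Matrix.mul_apply]
    refine Finset.sum_eq_zero fun r _ => ?_
    by_cases hr : r ∈ S i
    · rw [hN i r s fun h => h.1 hr, mul_zero]
    · rw [hN i t r fun h => hr h.2, zero_mul]
  have hblock : ∀ {i j : Q} (α : i ⟶ j), blockMatrix S (w ∘ Sum.inl) α = W α := by
    intro i j α
    ext t s
    simp only [blockMatrix, Matrix.of_apply]
    split_ifs with h
    · have hmem : A α *ᵥ (1 + N i).col s ∈ U.carrier j :=
        U.map_mem α ((1 + N i).col s) (hNmem i s h.2)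
      have hW : W α t s = ((1 - N j) *ᵥ (A α *ᵥ (1 + N i).col s)) t := by
        simp only [W, Matrix.mul_assoc]
        rfl
      rw [hW, Matrix.sub_mulVec, Matrix.one_mulVec, Pi.sub_apply,
        ← hNcoord j _ hmem t h.1, sub_self]
    · rfl
  rw [chartMap, hnil, hnil, hblock]
  have hinv : ∀ i, (1 + N i) * (1 - N i) = 1 := fun i => by
    rw [add_mul, mul_sub, mul_sub, hNN]; simp
  have hfin : (1 + N x.2.1) * W x.2.2.1 * (1 - N x.1) = A x.2.2.1 := by
    simp only [W]
    rw [← Matrix.mul_assoc, ← Matrix.mul_assoc, hinv, Matrix.one_mul, Matrix.mul_assoc, hinv,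
      Matrix.mul_one]
  rw [hfin]
  rfl

end Chart

end QuiverExpander

end

/-! ### The Cartan form, the slope bound and uniform expanders. -/

noncomputable section

namespace QuiverExpander

section Cartan

variable {Q : Type*} [Quiver Q] [Fintype Q] [∀ i j : Q, Fintype (i ⟶ j)]

theorem symForm_comm (x y : Q → ℝ) : symForm Q x y = symForm Q y x := by
  simp [symForm, add_comm]

theorem symForm_self (x : Q → ℝ) : symForm Q x x = 2 * eulerForm Q x x := by
  simp [symForm, two_mul]

theorem antisymForm_apply (x y : Q → ℝ) :
    antisymForm Q x y = symForm Q x y - 2 * eulerForm Q y x := by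
  simp [symForm, antisymForm]
  ring

variable [DecidableEq Q]

theorem eulerForm_single (i j : Q) : eulerForm Q (Pi.single i 1) (Pi.single j 1) =
    (if i = j then 1 else 0) - Fintype.card (i ⟶ j) := by
  rw [eulerForm_apply]
  congr 1
  · simp [Pi.single_apply, eq_comm]
  · simp only [Finset.sum_const, Finset.card_univ, nsmul_eq_mul, Pi.single_apply]
    simp [mul_ite]

theorem symForm_single (i j : Q) : symForm Q (Pi.single i 1) (Pi.single j 1) =
    (if i = j then 2 else 0) - (Fintype.card (i ⟶ j) + Fintype.card (j ⟶ i)) := by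
  rw [symForm, LinearMap.add_apply, LinearMap.add_apply, LinearMap.BilinForm.flip_apply,
    eulerForm_single, eulerForm_single]
  by_cases h : i = j
  · subst h; simp; ring
  · simp [h, Ne.symm h]; ring

theorem symForm_single_self (hQ : IsAcyclic Q) (i : Q) :
    symForm Q (Pi.single i 1) (Pi.single i 1) = 2 := by
  have : IsEmpty (i ⟶ i) := ⟨fun α => by simpa using hQ i α.toPath⟩
  rw [symForm_single]
  simp

theorem symForm_single_neg {i j : Q} (hij : i ≠ j) (h : Nonempty ((i ⟶ j) ⊕ (j ⟶ i))) :
    symForm Q (Pi.single i 1) (Pi.single j 1) < 0 := by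
  rw [symForm_single, if_neg hij]
  obtain ⟨α | α⟩ := h
  · have : 0 < Fintype.card (i ⟶ j) := Fintype.card_pos_iff.2 ⟨α⟩
    have : (0 : ℝ) < Fintype.card (i ⟶ j) := by exact_mod_cast this
    have : (0 : ℝ) ≤ Fintype.card (j ⟶ i) := by positivity
    linarith
  · have : 0 < Fintype.card (j ⟶ i) := Fintype.card_pos_iff.2 ⟨α⟩
    have : (0 : ℝ) < Fintype.card (j ⟶ i) := by exact_mod_cast this
    have : (0 : ℝ) ≤ Fintype.card (i ⟶ j) := by positivity
    linarith

/-- A small step `t > 0` along `i` stays in the domain but raises `(d, i)` by `2t`, as there are no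
loops. -/
theorem symForm_single_neg_of_mem_interior (hQ : IsAcyclic Q) {d : Q → ℝ}
    (hd : d ∈ interior (fundamentalDomain Q)) (i : Q) : symForm Q d (Pi.single i 1) < 0 := by
  have hcont : Continuous fun t : ℝ => d + t • (Pi.single i 1 : Q → ℝ) := by fun_prop
  have hev : ∀ᶠ t : ℝ in nhds 0, d + t • (Pi.single i 1 : Q → ℝ) ∈ fundamentalDomain Q := by
    have h0 : d + (0 : ℝ) • (Pi.single i 1 : Q → ℝ) = d := by simp
    exact hcont.continuousAt (h0.symm ▸ mem_interior_iff_mem_nhds.1 hd)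
  obtain ⟨t, ht, ht0⟩ := (((hev.filter_mono nhdsWithin_le_nhds).and
    (self_mem_nhdsWithin (s := Set.Ioi (0 : ℝ))))).exists
  have h1 := ht.2 i
  simp only [map_add, map_smul, LinearMap.add_apply, LinearMap.smul_apply, smul_eq_mul,
    symForm_single_self hQ] at h1
  have h2 : 0 < t := ht0
  linarith

theorem isStrictlyFundamental_symForm (hQ : IsAcyclic Q) (hconn : IsConnected Q) {d : Q → ℝ}
    (hd : d ∈ interior (fundamentalDomain Q)) : IsStrictlyFundamental (symForm Q) d where
  symm := symForm_comm
  off_diag i j hij := by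
    rw [symForm_single, if_neg hij, zero_sub]
    exact neg_nonpos.2 (by positivity)
  connected p hp i j hi := by
    obtain ⟨q⟩ := hconn.2 i j
    induction q with
    | nil => exact hi
    | @cons b c q α ih =>
      by_cases hbc : (b : Q) = c
      · subst hbc; exact ih
      · exact hp b c hbc (symForm_single_neg hbc ⟨α⟩) ih
  pos := (interior_subset hd).1
  neg := symForm_single_neg_of_mem_interior hQ hd
  nonempty := hconn.1

/-- The numerical bound for real vectors `x` with `0 ≤ x ≤ d`. -/
theorem IsStrictlyFundamental.exists_le_slope_sub_slope {d : Q → ℝ}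
    (h : IsStrictlyFundamental (symForm Q) d) :
    ∃ C : ℝ, 0 < C ∧ ∀ δ : ℝ, ∀ x ∈ Set.Icc 0 d, x ≠ 0 → 0 ≤ eulerForm Q x (d - x) →
      (-symForm Q d) x ≤ δ * (-symForm Q d) d →
      C * (1 - δ) ≤ slope (antisymForm Q d) (-symForm Q d) d -
        slope (antisymForm Q d) (-symForm Q d) x := by
  obtain ⟨C, hC, hbound⟩ := h.exists_form_sub_le
  refine ⟨C, hC, fun δ x hx hx0 heuler hδ => ?_⟩
  have hdd := h.form_self_neg
  have hdx := h.form_neg hx.1 hx0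
  have hslope : slope (antisymForm Q d) (-symForm Q d) d = 0 := by
    simp [slope, antisymForm]
  simp only [LinearMap.neg_apply] at hδ
  have h1 := hbound x hx
  -- The Euler condition says `⟨x, d⟩ ≥ ⟨x, x⟩ = (x, x) / 2`.
  have h2 : antisymForm Q d x ≤ symForm Q x (d - x) := by
    rw [antisymForm_apply, map_sub, symForm_comm x d, symForm_self]
    rw [map_sub] at heuler
    linarith
  have h3 : symForm Q d (d - x) ≤ (1 - δ) * symForm Q d d := by
    rw [map_sub]; linarith
  have h4 : C * (symForm Q d x * symForm Q d (d - x)) ≥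
      C * (symForm Q d x * ((1 - δ) * symForm Q d d)) :=
    mul_le_mul_of_nonneg_left (mul_le_mul_of_nonpos_left h3 hdx.le) hC.le
  have h5 : antisymForm Q d x * -symForm Q d d ≤
      (-(C * (1 - δ)) * -symForm Q d x) * -symForm Q d d := by
    have := mul_le_mul_of_nonneg_right h2 (neg_pos.2 hdd).le
    linarith
  have h6 := le_of_mul_le_mul_right h5 (neg_pos.2 hdd)
  have h7 : slope (antisymForm Q d) (-symForm Q d) x ≤ -(C * (1 - δ)) := by
    rw [slope, LinearMap.neg_apply]
    exact (div_le_iff₀ (neg_pos.2 hdx)).2 h6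
  rw [hslope]
  linarith

end Cartan

theorem slope_smul {Q : Type*} (Θ κ : Module.Dual ℝ (Q → ℝ)) {c : ℝ} (hc : c ≠ 0) (x : Q → ℝ) :
    slope Θ κ (c • x) = slope Θ κ x := by
  simp only [slope, map_smul, smul_eq_mul]
  exact mul_div_mul_left _ _ hc

theorem Subrep.IsNonzero.dimVec_ne_zero {F Q : Type*} [Field F] [Quiver Q] {V : Rep F Q}
    {U : Subrep V} (hU : U.IsNonzero) : U.dimVec ≠ 0 := fun h => by
  obtain ⟨i, hi⟩ := hU
  exact hi (Submodule.finrank_eq_zero.1 (congrFun h i))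

theorem vec_nsmul {Q : Type*} (k : ℕ) (d : Q → ℕ) : vec (k • d) = (k : ℝ) • vec d := by
  ext i
  simp [vec]

theorem vec_mono {Q : Type*} {d e : Q → ℕ} (h : d ≤ e) : vec d ≤ vec e := fun i => by
  simpa [vec] using h i

theorem vec_nonneg {Q : Type*} (d : Q → ℕ) : 0 ≤ vec d := fun i => Nat.cast_nonneg (d i)

theorem vec_ne_zero {Q : Type*} {d : Q → ℕ} (h : d ≠ 0) : vec d ≠ 0 := fun hc =>
  h (funext fun i => by simpa [vec] using congrFun hc i)

/-- If the numerical bound holds for all real vectors `x` with `0 ≤ x ≤ d`, then the multiples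
of `d` support a uniform expander over every infinite field. -/
theorem supportsUniformExpander_nsmul.{u, v, w} (F : Type u) [Field F] [Infinite F] {Q : Type v}
    [Quiver.{w} Q] [Fintype Q] [∀ i j : Q, Fintype (i ⟶ j)] {Θ κ : Module.Dual ℝ (Q → ℝ)}
    {d : Q → ℕ} (hd : d ≠ 0) {C : ℝ} (hC : 0 < C)
    (hbound : ∀ δ : ℝ, ∀ x ∈ Set.Icc 0 (vec d), x ≠ 0 → 0 ≤ eulerForm Q x (vec d - x) →
      κ x ≤ δ * κ (vec d) → C * (1 - δ) ≤ slope Θ κ (vec d) - slope Θ κ x) :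
    SupportsUniformExpander F Θ κ (fun k : ℕ+ => (k : ℕ) • d) := by
  choose V hVdim hV using fun k : ℕ+ =>
    exists_rep_forall_subrep_eulerForm_nonneg.{u, v, w} F ((k : ℕ) • d)
  refine ⟨V, ⟨fun N => ?_, fun δ _ hδ1 => ?_⟩, hVdim⟩
  · obtain ⟨i, hi⟩ := Function.ne_iff.1 hd
    refine ⟨N.succPNat, ?_⟩
    rw [hVdim]
    refine le_trans ?_ (Finset.single_le_sum (fun j _ => Nat.zero_le _) (Finset.mem_univ i))
    simp only [Nat.succPNat_coe, Pi.smul_apply, smul_eq_mul]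
    exact (Nat.le_succ N).trans (Nat.le_mul_of_pos_right _ (Nat.pos_of_ne_zero hi))
  · have hpos : 0 < C * (1 - δ) := mul_pos hC (sub_pos.2 hδ1)
    -- Halving makes the inequality strict.
    refine ⟨C * (1 - δ) / 2, half_pos hpos, fun k U hU hκ => ?_⟩
    obtain ⟨hle, heuler⟩ := hV k U
    have hk : (0 : ℝ) < (k : ℕ) := by exact_mod_cast k.pos
    rw [hVdim, vec_nsmul] at hκ ⊢
    rw [vec_nsmul] at heuler
    -- In general `x` is not integral, hence the bound for real vectors. All conditions are
    -- homogeneous, and slopes are scale invariant.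
    set x : Q → ℝ := ((k : ℕ) : ℝ)⁻¹ • vec U.dimVec with hx
    have hUx : vec U.dimVec = ((k : ℕ) : ℝ) • x := (smul_inv_smul₀ hk.ne' _).symm
    have hx0 : x ≠ 0 := smul_ne_zero (inv_ne_zero hk.ne') (vec_ne_zero hU.dimVec_ne_zero)
    have hxmem : x ∈ Set.Icc 0 (vec d) := by
      refine ⟨smul_nonneg (inv_nonneg.2 hk.le) (vec_nonneg _), ?_⟩
      have h1 := vec_mono hle
      rw [vec_nsmul, hUx] at h1
      exact (smul_le_smul_iff_of_pos_left hk).1 h1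
    rw [hUx, ← smul_sub, map_smul, map_smul, LinearMap.smul_apply, smul_eq_mul, smul_eq_mul]
      at heuler
    rw [hUx, map_smul κ _ x, map_smul κ _ (vec d), smul_eq_mul, smul_eq_mul, mul_left_comm] at hκ
    have h2 := hbound δ x hxmem hx0
      (nonneg_of_mul_nonneg_right (nonneg_of_mul_nonneg_right heuler hk) hk)
      (le_of_mul_le_mul_left hκ hk)
    rw [hUx, slope_smul Θ κ hk.ne', slope_smul Θ κ hk.ne']
    linarith

end QuiverExpander

end

theorem corollary5p4 (F : Type*) [Field F] [IsAlgClosed F]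
    (Q : Type*) [Quiver Q] [Fintype Q] [DecidableEq Q] [∀ i j : Q, Fintype (i ⟶ j)]
    (hacyclic : QuiverExpander.IsAcyclic Q) (hconn : QuiverExpander.IsConnected Q)
    (hwild : QuiverExpander.IsWild Q)
    (d : Q → ℕ)
    (hd : QuiverExpander.vec d ∈ interior (QuiverExpander.fundamentalDomain Q))
    (γ : ℝ) (hγ_nonneg : 0 ≤ γ)
    (hγ : QuiverExpander.symForm Q (QuiverExpander.vec d) (QuiverExpander.vec d) =
      (QuiverExpander.cartanEigenvalue Q 0 + γ) *
        dotProduct (QuiverExpander.vec d) (QuiverExpander.vec d))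
    (hγ_small :
      (0 ≤ QuiverExpander.cartanEigenvalue Q 1 → γ < -QuiverExpander.cartanEigenvalue Q 0) ∧
      (QuiverExpander.cartanEigenvalue Q 1 < 0 →
        γ < QuiverExpander.cartanEigenvalue Q 0 *
            (QuiverExpander.cartanEigenvalue Q 1 - QuiverExpander.cartanEigenvalue Q 0) /
          (QuiverExpander.cartanEigenvalue Q 0 + QuiverExpander.cartanEigenvalue Q 1)))
    (Θ κ : Module.Dual ℝ (Q → ℝ))
    (hΘ : Θ = QuiverExpander.antisymForm Q (QuiverExpander.vec d))
    (hκ : κ = -QuiverExpander.symForm Q (QuiverExpander.vec d)) :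
    (∃ C : ℝ, 0 < C ∧ ∀ δ : ℝ, 0 < δ → δ < 1 →
      ((C * (1 - δ) : ℝ) : EReal) ≤ QuiverExpander.effBound Θ κ d δ ∧ 0 < C * (1 - δ)) ∧
    QuiverExpander.SupportsUniformExpander F Θ κ (fun k : ℕ+ => (k : ℕ) • d) := by
  open QuiverExpander in
  subst hΘ hκ
  have h := isStrictlyFundamental_symForm hacyclic hconn hd
  obtain ⟨C, hC, hbound⟩ := h.exists_le_slope_sub_slope
  have hd0 : d ≠ 0 := fun hc => h.ne_zero (funext fun i => by simp [vec, hc])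
  refine ⟨⟨C, hC, fun δ _ hδ1 => ⟨le_sInf ?_, mul_pos hC (sub_pos.2 hδ1)⟩⟩,
    supportsUniformExpander_nsmul F hd0 hC hbound⟩
  rintro r ⟨e, he0, hed, heuler, hκ, rfl⟩
  exact EReal.coe_le_coe_iff.2
    (hbound δ (vec e) ⟨vec_nonneg e, vec_mono hed⟩ (vec_ne_zero he0) heuler hκ)
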